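/- For every integer $r\ge 4$ there is a constant $\Delta_r$ such that the following holds. Let $G=(V,E)$ be a finite simple graph with maximum degree $\Delta\ge\Delta_r$, and let $\mathcal H=(L,H)$ be a $k$-fold cover of $G$ with $$k\ \ge\ 2(r-2)\,\Delta\,\frac{\log_2\log_2\Delta}{\log_2\Delta}.$$ If $\mathcal H$ is $K_r$-free, then $G$ is $\mathcal H$-colourable. Here a $k$-fold cover of $G$ is a pair $(L,H)$ where $L$ assigns to every $v\in V$ a set $L(v)$ of exactly $k$ positive integers, and $H$ is a graph whose vertex set is the disjoint union of the sets $L_v=\{v_c: c\in L(v)\}$, $v\in V$, such that every $L_v$ induces a complete graph in $H$ and, for distinct $u,v\in V$, the edges of $H$ between $L_u$ and $L_v$ form a (possibly empty) matching if $uv\in E$, while there are none if $uv\notin E$. The graph $H^*$ is obtained from $H$ by deleting all edges inside the sets $L_v$, $v\in V$; the cover is $K_r$-free if $H^*$ contains no complete subgraph on $r$ vertices. The graph $G$ is $\mathcal H$-colourable if $H$ has an independent set of size $|V|$. -/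

import Mathlib

/-- A `k`-fold cover `(L, H)` of a graph `G`. The vertex `v_c` of `H` (the copy of `v` indexed by
the colour `c ∈ L v`) is `⟨v, c⟩`, so the vertex set of `H` is the disjoint union of the
`v`-sets `L_v = {v_c : c ∈ L v}`. -/
structure DPCover {V : Type*} (G : SimpleGraph V) (k : ℕ) where
  /-- the list assignment -/
  L : V → Finset ℕ+
  /-- every list has exactly `k` colours -/
  card_L : ∀ v, (L v).card = k
  /-- the conflict graph of the cover -/
  H : SimpleGraph ((v : V) × L v)
  /-- every `v`-set induces a complete graph -/
  isClique_vSet : ∀ v, H.IsClique {x | x.1 = v}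
  /-- there are no edges between the `v`-sets of distinct non-adjacent vertices -/
  adj_of_adj : ∀ x y, H.Adj x y → x.1 ≠ y.1 → G.Adj x.1 y.1
  /-- the edges between the `v`-sets of two adjacent vertices form a (possibly empty) matching:
  a vertex `x` of one of them has at most one neighbour in the other one -/
  matching : ∀ x y z, G.Adj x.1 y.1 → y.1 = z.1 → H.Adj x y → H.Adj x z → y = z

namespace DPCover

/-- The graph `H*`: remove from `H` every edge inside a `v`-set. -/
def star {V : Type*} {G : SimpleGraph V} {k : ℕ} (C : DPCover G k) :
    SimpleGraph ((v : V) × C.L v) where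
  Adj x y := C.H.Adj x y ∧ x.1 ≠ y.1
  symm := ⟨fun _ _ h => ⟨h.1.symm, h.2.symm⟩⟩
  loopless := ⟨fun _ h => h.2 rfl⟩

/-- The cover is `K_r`-free: `H*` contains no complete graph on `r` vertices. -/
def IsCliqueFree {V : Type*} {G : SimpleGraph V} {k : ℕ} (C : DPCover G k) (r : ℕ) : Prop :=
  C.star.CliqueFree r

/-- `G` is colourable from the cover: `H` has an independent set of size `|V(G)|`. -/
def Colorable {V : Type*} [Fintype V] {G : SimpleGraph V} {k : ℕ} (C : DPCover G k) : Prop :=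
  ∃ I : Finset ((v : V) × C.L v), C.H.IsIndepSet (I : Set ((v : V) × C.L v)) ∧
    I.card = Fintype.card V

end DPCover

/-!
The proof counts colourings in the manner of Rosenfeld. Write `#(S)` for the number of colourings
of the vertex set `S` from the cover. It is enough that `#(S ∪ {v}) ≥ ℓ * #(S)` for all `S` and all
`v ∉ S`, where `ℓ` is a power of `log Δ` (`DPCover.mul_card_cols_le`); this goes by induction on
`S`. Since `#(S ∪ {v})` is the sum over the copies `x` of `v` of the number of colourings of `S`
that contain no neighbour of `x`, many pairs `(x, I)` must be found for which the colouring `I` of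
`S` contains no neighbour of `x` in `H*`.

For a copy `x` and a colouring `I` let `U` be the set of the members of `I` that are adjacent to
`x`. As every member of `I` is adjacent to at most one copy of `v`, the sets `U` have at most
`Δ / k` elements on average. By the induction hypothesis it is rare that few copies of a vertex are
available in a colouring. So, if `M + 1` exceeds `Δ / k` by a constant factor, a constant fraction
of the pairs `(x, I)` is good: `U` has at most `M` elements, and each coloured vertex that it meets
has many available copies (`DPCover.le_sum_card_good`).

Fix `x`. Recolouring the vertices of `U` in a good colouring leads to a colouring `I'` without
neighbours of `x`. Conversely, from such an `I'` one returns by switching on an independent set of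
neighbours of `x`, each of which is compatible with `I'`. Let every compatible neighbour be
switchable at random, with probability about one over the number of available copies of its vertex.
Then each colouring is reached with total weight at most `1`, and each good one with weight at
least `2 ^ (-M)` (`DPCover.sum_fiber_switches_le_one`, `DPCover.le_sum_fiber_switches`), while the
sets that can be switched on in `I'` are the independent subsets of a random set `A` of neighbours
of `x`.

Now the clique condition enters: `A` induces a graph without `K_{r-1}`, so it contains an
independent set of size about `|A| ^ (1 / (r - 2))`, hence very many independent subsets unless
`|A|` is at most a power of `log Δ` (`SimpleGraph.exists_indep_of_pow_le`). On the other hand only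
about `|A| ^ M` of its subsets have at most `M` elements. Therefore the colourings that come from a
large `A` are negligible, and each of the remaining `I'` accounts for good ones of weight at most
about `(log Δ) ^ ((r - 2) M) ≤ Δ ^ (3 / 4)`, whence there are at least `Δ ^ (-3 / 4 - o(1))` times
as many `I'` as good colourings. Summed over the `k` copies of `v` this gives `ℓ * #(S)`.
-/

/-! ### Colourings and available copies -/

section Covers

open Finset
open scoped Classical

namespace DPCover

variable {V : Type*} {G : SimpleGraph V} {k : ℕ} (C : DPCover G k)

/-- The vertices of the conflict graph of a cover: `⟨v, c⟩` is the copy `v_c` of `v`. -/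
abbrev Copy : Type _ := (v : V) × C.L v

/-- The copy `y` has no neighbour in `I` outside its own `v`-set. -/
def Free (I : Finset C.Copy) (y : C.Copy) : Prop := ∀ z ∈ I, ¬ C.star.Adj y z

variable {C}

lemma Free.mono {I J : Finset C.Copy} {y : C.Copy} (h : C.Free J y) (hIJ : I ⊆ J) : C.Free I y :=
  fun z hz => h z (hIJ hz)

lemma free_union {I J : Finset C.Copy} {y : C.Copy} :
    C.Free (I ∪ J) y ↔ C.Free I y ∧ C.Free J y := by
  simp only [Free, mem_union]
  exact ⟨fun h => ⟨fun z hz => h z (.inl hz), fun z hz => h z (.inr hz)⟩,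
    fun h z hz => hz.elim (h.1 z) (h.2 z)⟩

lemma not_star_adj_of_fst_eq {x y : C.Copy} (h : x.1 = y.1) : ¬ C.star.Adj x y :=
  fun hxy => hxy.2 h

lemma eq_of_star_adj {x y z : C.Copy} (hy : C.star.Adj x y) (hz : C.star.Adj x z)
    (h : y.1 = z.1) : y = z :=
  C.matching x y z (C.adj_of_adj x y hy.1 hy.2) h hy.1 hz.1

variable [Fintype V]

variable (C) in
/-- The copies of `v` that are compatible with all of `I`. A member of `I` that is itself a copy of
`v` plays no role, as `H*` has no edges inside a `v`-set. -/
noncomputable def avail (I : Finset C.Copy) (v : V) : Finset C.Copy :=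
  univ.filter fun y => y.1 = v ∧ C.Free I y

variable (C) in
/-- The colourings of the vertex set `S` from the lists `B`, each given as the set of the chosen
copies. -/
noncomputable def colorings (B : V → Finset C.Copy) (S : Finset V) : Finset (Finset C.Copy) :=
  univ.filter fun I => (∀ y ∈ I, C.Free I y) ∧ I.image Sigma.fst = S ∧
    Set.InjOn Sigma.fst (I : Set C.Copy) ∧ ∀ y ∈ I, y ∈ B y.1

variable (C) in
/-- The neighbours of `x` in `H*`. -/
noncomputable def nbr (x : C.Copy) : Finset C.Copy := univ.filter fun y => C.star.Adj x y

lemma mem_avail {I : Finset C.Copy} {v : V} {y : C.Copy} :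
    y ∈ C.avail I v ↔ y.1 = v ∧ C.Free I y := by simp [avail]

lemma mem_nbr {x y : C.Copy} : y ∈ C.nbr x ↔ C.star.Adj x y := by simp [nbr]

lemma mem_colorings {B : V → Finset C.Copy} {S : Finset V} {I : Finset C.Copy} :
    I ∈ C.colorings B S ↔ (∀ y ∈ I, C.Free I y) ∧ I.image Sigma.fst = S ∧
      Set.InjOn Sigma.fst (I : Set C.Copy) ∧ ∀ y ∈ I, y ∈ B y.1 := by simp [colorings]

lemma avail_anti {I J : Finset C.Copy} (h : I ⊆ J) (v : V) : C.avail J v ⊆ C.avail I v :=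
  fun _ hy => mem_avail.2 ⟨(mem_avail.1 hy).1, (mem_avail.1 hy).2.mono h⟩

lemma card_filter_star_adj_le_one (z : C.Copy) (v : V) :
    #(univ.filter fun y : C.Copy => y.1 = v ∧ C.star.Adj z y) ≤ 1 := by
  rw [card_le_one]
  intro a ha b hb
  simp only [mem_filter, mem_univ, true_and] at ha hb
  exact eq_of_star_adj ha.2 hb.2 (ha.1.trans hb.1.symm)

lemma card_avail_empty (v : V) : #(C.avail ∅ v) = k := by
  refine Eq.trans ?_ ((Fintype.card_coe (C.L v)).trans (C.card_L v))
  rw [← card_univ]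
  symm
  refine card_bij (fun c _ => (⟨v, c⟩ : C.Copy)) ?_ ?_ ?_
  · intro c _
    simp [mem_avail, Free]
  · intro a _ b _ h
    simpa using h
  · rintro ⟨w, c⟩ hb
    obtain rfl : w = v := (mem_avail.1 hb).1
    exact ⟨c, mem_univ _, rfl⟩

/-- Each member of `J` conflicts with at most one copy of any given vertex. -/
lemma card_le_card_filter_free_add {B : Finset C.Copy} {v : V} (hB : ∀ y ∈ B, y.1 = v)
    (J : Finset C.Copy) : #B ≤ #(B.filter (C.Free J)) + #J := by
  rw [← card_filter_add_card_filter_not (s := B) (C.Free J)]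
  refine Nat.add_le_add_left ?_ _
  calc #(B.filter fun y => ¬ C.Free J y)
      ≤ #(J.biUnion fun z => univ.filter fun y : C.Copy => y.1 = v ∧ C.star.Adj z y) := by
        apply card_le_card
        intro y hy
        rw [mem_filter] at hy
        obtain ⟨hyB, hy⟩ := hy
        simp only [Free, not_forall, not_not] at hy
        obtain ⟨z, hz, hyz⟩ := hy
        simp only [mem_biUnion, mem_filter, mem_univ, true_and]
        exact ⟨z, hz, hB y hyB, hyz.symm⟩
    _ ≤ #J * 1 := card_biUnion_le_card_mul _ _ _ fun z _ => card_filter_star_adj_le_one z v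
    _ = #J := mul_one _

lemma card_avail_le_add (I J : Finset C.Copy) (v : V) :
    #(C.avail I v) ≤ #(C.avail (I ∪ J) v) + #J := by
  refine (card_le_card_filter_free_add (v := v) (fun y hy => (mem_avail.1 hy).1) J).trans ?_
  gcongr
  intro y hy
  simp only [mem_filter, mem_avail] at hy ⊢
  exact ⟨hy.1.1, free_union.2 ⟨hy.1.2, hy.2⟩⟩

lemma card_of_mem_colorings {B : V → Finset C.Copy} {S : Finset V} {I : Finset C.Copy}
    (hI : I ∈ C.colorings B S) : #I = #S := by
  obtain ⟨-, h2, h3, -⟩ := mem_colorings.1 hI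
  rw [← h2, card_image_of_injOn h3]

lemma fst_mem_of_mem_colorings {B : V → Finset C.Copy} {S : Finset V} {I : Finset C.Copy}
    (hI : I ∈ C.colorings B S) {y : C.Copy} (hy : y ∈ I) : y.1 ∈ S := by
  rw [← (mem_colorings.1 hI).2.1]
  exact mem_image_of_mem _ hy

lemma exists_mem_of_mem_colorings {B : V → Finset C.Copy} {S : Finset V} {I : Finset C.Copy}
    (hI : I ∈ C.colorings B S) {v : V} (hv : v ∈ S) : ∃ y ∈ I, y.1 = v := by
  rw [← (mem_colorings.1 hI).2.1] at hv
  simpa using hv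

/-- A colouring of `insert u S` is a colouring of `S` together with a compatible copy of `u`. -/
lemma sum_colorings_insert {B : V → Finset C.Copy} (hB : ∀ v, ∀ y ∈ B v, y.1 = v)
    {S : Finset V} {u : V} (hu : u ∉ S) {R : Type*} [AddCommMonoid R] (f : Finset C.Copy → R) :
    ∑ I ∈ C.colorings B (insert u S), f I =
      ∑ T ∈ C.colorings B S, ∑ y ∈ (B u).filter (C.Free T), f (insert y T) := by
  rw [sum_sigma']
  symm
  have key : ∀ T ∈ C.colorings B S, ∀ y, y.1 = u → (insert y T).filter (fun z => z.1 ≠ u) = T := by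
    intro T hT y hy
    ext z
    simp only [mem_filter, mem_insert]
    constructor
    · rintro ⟨rfl | hz, h⟩
      · exact absurd hy h
      · exact hz
    · intro hz
      refine ⟨.inr hz, ?_⟩
      rintro rfl
      exact hu (fst_mem_of_mem_colorings hT hz)
  refine sum_bij (fun p _ => insert p.2 p.1) ?_ ?_ ?_ ?_
  · rintro ⟨T, y⟩ h
    simp only [mem_sigma, mem_filter] at h
    obtain ⟨hT, hy, hf⟩ := h
    have hyu := hB u y hy
    obtain ⟨h1, h2, h3, h4⟩ := mem_colorings.1 hT
    refine mem_colorings.2 ⟨?_, ?_, ?_, ?_⟩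
    · intro z hz w hw
      rw [mem_insert] at hz hw
      rcases hz with rfl | hz <;> rcases hw with rfl | hw
      · exact C.star.loopless.irrefl _
      · exact hf w hw
      · exact fun h => hf z hz h.symm
      · exact h1 z hz w hw
    · rw [image_insert, h2]
      simp [hyu]
    · rw [coe_insert, Set.injOn_insert]
      · refine ⟨h3, ?_⟩
        rintro ⟨z, hz, hzy⟩
        exact hu (hyu ▸ hzy ▸ fst_mem_of_mem_colorings hT hz)
      · intro hyT
        exact hu (hyu ▸ fst_mem_of_mem_colorings hT hyT)
    · intro z hz
      rw [mem_insert] at hz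
      rcases hz with rfl | hz
      · rw [hyu]; exact hy
      · exact h4 z hz
  · rintro ⟨T, y⟩ h ⟨T', y'⟩ h' heq
    simp only [mem_sigma, mem_filter] at h h' heq
    have hyu := hB u y h.2.1
    have hyu' := hB u y' h'.2.1
    have hT : T = T' := by
      rw [← key T h.1 y hyu, heq, key T' h'.1 y' hyu']
    subst hT
    have hy : y ∈ insert y' T := heq ▸ mem_insert_self y T
    rw [mem_insert] at hy
    rcases hy with rfl | hy
    · rfl
    · exact absurd (hyu ▸ fst_mem_of_mem_colorings h.1 hy) hu
  · intro I hI
    obtain ⟨y, hyI, hyu⟩ := exists_mem_of_mem_colorings hI (mem_insert_self u S)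
    obtain ⟨h1, h2, h3, h4⟩ := mem_colorings.1 hI
    refine ⟨⟨I.filter fun z => z.1 ≠ u, y⟩, ?_, ?_⟩
    · simp only [mem_sigma, mem_filter]
      refine ⟨mem_colorings.2 ⟨?_, ?_, ?_, ?_⟩, ?_, ?_⟩
      · exact fun z hz => (h1 z (mem_filter.1 hz).1).mono (filter_subset _ _)
      · ext w
        simp only [mem_image, mem_filter]
        constructor
        · rintro ⟨z, ⟨hz, hzu⟩, rfl⟩
          exact (mem_insert.1 (fst_mem_of_mem_colorings hI hz)).resolve_left hzu
        · intro hw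
          obtain ⟨z, hz, rfl⟩ := exists_mem_of_mem_colorings hI (mem_insert_of_mem hw)
          exact ⟨z, ⟨hz, fun h => hu (h ▸ hw)⟩, rfl⟩
      · exact h3.mono (by intro z hz; exact (mem_filter.1 hz).1)
      · exact fun z hz => h4 z (mem_filter.1 hz).1
      · exact hyu ▸ h4 y hyI
      · exact (h1 y hyI).mono (filter_subset _ _)
    · ext z
      simp only [mem_insert, mem_filter]
      constructor
      · rintro (rfl | hz)
        · exact hyI
        · exact hz.1
      · intro hz
        by_cases hzu : z.1 = u
        · exact .inl (h3 hz hyI (hzu.trans hyu.symm))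
        · exact .inr ⟨hz, hzu⟩
  · intros; rfl

lemma card_colorings_insert {B : V → Finset C.Copy} (hB : ∀ v, ∀ y ∈ B v, y.1 = v)
    {S : Finset V} {u : V} (hu : u ∉ S) :
    #(C.colorings B (insert u S)) = ∑ T ∈ C.colorings B S, #((B u).filter (C.Free T)) := by
  have := sum_colorings_insert hB hu (fun _ => 1)
  simpa using this

lemma card_colorings_empty (B : V → Finset C.Copy) : #(C.colorings B ∅) = 1 := by
  rw [card_eq_one]
  refine ⟨∅, ?_⟩
  ext I
  simp only [mem_colorings, image_eq_empty, mem_singleton]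
  constructor
  · exact fun h => h.2.1
  · rintro rfl
    simp

lemma card_colorings_le_prod {B : V → Finset C.Copy} (hB : ∀ v, ∀ y ∈ B v, y.1 = v)
    (S : Finset V) : #(C.colorings B S) ≤ ∏ u ∈ S, #(B u) := by
  induction S using Finset.induction_on with
  | empty => simp [card_colorings_empty]
  | insert u S hu ih =>
    rw [card_colorings_insert hB hu, prod_insert hu, mul_comm]
    calc _ ≤ ∑ T ∈ C.colorings B S, #(B u) := sum_le_sum fun T _ => card_filter_le _ _
      _ = #(C.colorings B S) * #(B u) := by simp
      _ ≤ _ := by gcongr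

/-- Greedy choice: every earlier choice spoils at most one element of each later list. -/
lemma prod_le_card_colorings {B : V → Finset C.Copy} (hB : ∀ v, ∀ y ∈ B v, y.1 = v)
    (S : Finset V) (n : ℕ) (hn : #S ≤ n) : ∏ u ∈ S, (#(B u) - n) ≤ #(C.colorings B S) := by
  induction S using Finset.induction_on with
  | empty => simp [card_colorings_empty]
  | insert u S hu ih =>
    rw [card_insert_of_notMem hu] at hn
    rw [card_colorings_insert hB hu, prod_insert hu, mul_comm]
    calc _ ≤ #(C.colorings B S) * (#(B u) - n) := by gcongr; exact ih (by omega)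
      _ = ∑ T ∈ C.colorings B S, (#(B u) - n) := by simp
      _ ≤ _ := by
        refine sum_le_sum fun T hT => ?_
        have := card_le_card_filter_free_add (hB u) T
        rw [card_of_mem_colorings hT] at this
        omega

lemma fst_eq_of_mem_avail {I : Finset C.Copy} : ∀ v, ∀ y ∈ C.avail I v, y.1 = v :=
  fun _ _ hy => (mem_avail.1 hy).1

variable (C) in
/-- All colourings of `S` from the cover. -/
noncomputable def cols (S : Finset V) : Finset (Finset C.Copy) := C.colorings (C.avail ∅) S

lemma mem_cols {S : Finset V} {I : Finset C.Copy} :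
    I ∈ C.cols S ↔ (∀ y ∈ I, C.Free I y) ∧ I.image Sigma.fst = S ∧
      Set.InjOn Sigma.fst (I : Set C.Copy) := by
  simp [cols, mem_colorings, mem_avail, Free]

lemma filter_avail_empty (T : Finset C.Copy) (v : V) :
    (C.avail ∅ v).filter (C.Free T) = C.avail T v := by
  ext y
  simp [mem_avail, Free]

lemma card_cols_insert {S : Finset V} {v : V} (hv : v ∉ S) :
    #(C.cols (insert v S)) =
      ∑ x ∈ C.avail ∅ v, #((C.cols S).filter fun I => C.Free I x) := by
  rw [cols, card_colorings_insert fst_eq_of_mem_avail hv]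
  exact sum_card_bipartiteAbove_eq_sum_card_bipartiteBelow _

/-- Few colourings leave few copies of `u` available, relative to the colourings of `S ∖ {u}`. -/
lemma card_filter_card_avail_le {S : Finset V} {u : V} (hu : u ∈ S) (t : ℕ) :
    #((C.cols S).filter fun I => #(C.avail I u) ≤ t) ≤ #(C.cols (S.erase u)) * t := by
  have h := sum_colorings_insert (C := C) (B := C.avail ∅) fst_eq_of_mem_avail
    (notMem_erase u S) (fun I => if #(C.avail I u) ≤ t then 1 else 0)
  rw [insert_erase hu] at h
  rw [card_filter]
  refine (le_of_eq h).trans ?_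
  rw [← smul_eq_mul, ← sum_const]
  refine sum_le_sum fun T _ => ?_
  rw [filter_avail_empty]
  have hav : ∀ y ∈ C.avail T u, C.avail (insert y T) u = C.avail T u := by
    intro y hy
    refine (avail_anti (subset_insert y T) u).antisymm fun z hz => ?_
    obtain ⟨hz1, hz2⟩ := mem_avail.1 hz
    refine mem_avail.2 ⟨hz1, ?_⟩
    intro w hw
    rcases mem_insert.1 hw with rfl | hw
    · exact not_star_adj_of_fst_eq (hz1.trans (mem_avail.1 hy).1.symm)
    · exact hz2 w hw
  rw [sum_congr rfl fun y hy => by rw [hav y hy]]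
  split_ifs with h
  · simpa using h
  · simp

/-- A vertex of `I` lies in the neighbourhood of at most one copy of `v`. -/
lemma sum_card_filter_adj_le [DecidableRel G.Adj] {S : Finset V} {I : Finset C.Copy}
    (hI : I ∈ C.cols S) (v : V) (P : V → Prop) [DecidablePred P] :
    ∑ x ∈ C.avail ∅ v, #(I.filter fun y => C.star.Adj x y ∧ P y.1) ≤
      #((G.neighborFinset v).filter fun u => u ∈ S ∧ P u) := by
  rw [← card_biUnion]
  · refine card_le_card_of_injOn Sigma.fst ?_ ?_
    · intro y hy
      simp only [coe_biUnion, Set.mem_iUnion, mem_coe, mem_filter, mem_avail] at hy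
      obtain ⟨x, ⟨hx, -⟩, hyI, hxy, hP⟩ := hy
      simp only [mem_coe, mem_filter, SimpleGraph.mem_neighborFinset]
      exact ⟨hx ▸ C.adj_of_adj x y hxy.1 hxy.2, fst_mem_of_mem_colorings hI hyI, hP⟩
    · refine (mem_cols.1 hI).2.2.mono ?_
      intro y hy
      simp only [coe_biUnion, Set.mem_iUnion, mem_coe, mem_filter] at hy
      obtain ⟨x, -, hyI, -⟩ := hy
      exact hyI
  · intro x hx x' hx' hne
    rw [Function.onFun, disjoint_left]
    intro y hy hy'
    simp only [mem_filter] at hy hy'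
    exact hne (eq_of_star_adj hy.2.1.symm hy'.2.1.symm
      (((mem_avail.1 hx).1).trans (mem_avail.1 hx').1.symm))

end DPCover

end Covers

/-! ### Switching on neighbours of a copy -/

section Switching

open Finset
open scoped Classical

namespace DPCover

variable {V : Type*} {G : SimpleGraph V} {k : ℕ} {C : DPCover G k}

/-- Recolour the vertices that have a copy in `U` with the members of `U`. -/
noncomputable def switch (I U : Finset C.Copy) : Finset C.Copy :=
  (I.filter fun z => z.1 ∉ U.image Sigma.fst) ∪ U

lemma mem_switch {I U : Finset C.Copy} {z : C.Copy} :
    z ∈ switch I U ↔ (z ∈ I ∧ ∀ y ∈ U, y.1 ≠ z.1) ∨ z ∈ U := by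
  rw [switch, mem_union, mem_filter, mem_image]
  push Not
  rfl

variable [Fintype V]

variable (C) in
/-- The subsets of `A` that are independent in `H*` and have at most `K` elements. -/
noncomputable def smallIndep (K : ℕ) (A : Finset C.Copy) : Finset (Finset C.Copy) :=
  A.powerset.filter fun U => #U ≤ K ∧ ∀ y ∈ U, C.Free U y

/-- The colourings of `S` that are compatible with `x`. -/
noncomputable def freeCols (x : C.Copy) (S : Finset V) : Finset (Finset C.Copy) :=
  (C.cols S).filter fun I => C.Free I x

/-- The neighbours of `x` that can replace the present choice in the colouring `I` of `S`. -/
noncomputable def targets (x : C.Copy) (S : Finset V) (I : Finset C.Copy) : Finset C.Copy :=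
  (C.nbr x).filter fun y => y.1 ∈ S ∧ C.Free I y

/-- The pairs of a colouring of `S` compatible with `x` and a set of at most `K` neighbours of `x`
that can be switched on simultaneously. -/
noncomputable def switches (K : ℕ) (x : C.Copy) (S : Finset V) :
    Finset (Σ _ : Finset C.Copy, Finset C.Copy) :=
  (freeCols x S).sigma fun I => C.smallIndep K (targets x S I)

/-- The rate at which `y` is switched on in the colouring `I`: about one over the number of copies
of `y.1` available in `I`. The summand `L` absorbs the change of that number under a switch of at
most `L` vertices. -/
noncomputable def rate (L : ℕ) (I : Finset C.Copy) (y : C.Copy) : ℝ :=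
  ((#(C.avail I y.1) : ℝ) + L)⁻¹

lemma mem_switches {K : ℕ} {x : C.Copy} {S : Finset V}
    {p : Σ _ : Finset C.Copy, Finset C.Copy} :
    p ∈ switches K x S ↔ (p.1 ∈ C.cols S ∧ C.Free p.1 x) ∧
      (∀ y ∈ p.2, C.star.Adj x y ∧ y.1 ∈ S ∧ C.Free p.1 y) ∧
      #p.2 ≤ K ∧ ∀ y ∈ p.2, C.Free p.2 y := by
  simp only [switches, mem_sigma, freeCols, mem_filter, smallIndep, mem_powerset, targets,
    subset_iff, mem_nbr]

lemma switch_mem_cols {K : ℕ} {x : C.Copy} {S : Finset V}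
    {p : Σ _ : Finset C.Copy, Finset C.Copy} (hp : p ∈ switches K x S) :
    switch p.1 p.2 ∈ C.cols S := by
  obtain ⟨⟨hI, hx⟩, hU, -, hind⟩ := mem_switches.1 hp
  obtain ⟨h1, h2, h3⟩ := mem_cols.1 hI
  refine mem_cols.2 ⟨?_, ?_, ?_⟩
  · intro y hy z hz
    rcases mem_switch.1 hy with ⟨hy, -⟩ | hy <;> rcases mem_switch.1 hz with ⟨hz, -⟩ | hz
    · exact h1 y hy z hz
    · exact fun h => (hU z hz).2.2 y hy h.symm
    · exact (hU y hy).2.2 z hz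
    · exact hind y hy z hz
  · ext v
    rw [mem_image]
    constructor
    · rintro ⟨y, hy, rfl⟩
      rcases mem_switch.1 hy with ⟨hy, -⟩ | hy
      · exact fst_mem_of_mem_colorings hI hy
      · exact (hU y hy).2.1
    · intro hv
      by_cases h : ∃ y ∈ p.2, y.1 = v
      · obtain ⟨y, hy, rfl⟩ := h
        exact ⟨y, mem_switch.2 (.inr hy), rfl⟩
      · push Not at h
        obtain ⟨z, hz, rfl⟩ := exists_mem_of_mem_colorings hI hv
        exact ⟨z, mem_switch.2 (.inl ⟨hz, h⟩), rfl⟩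
  · intro y hy z hz h
    rcases mem_switch.1 hy with ⟨hy, hy'⟩ | hy <;> rcases mem_switch.1 hz with ⟨hz, hz'⟩ | hz
    · exact h3 hy hz h
    · exact absurd h.symm (hy' z hz)
    · exact absurd h (hz' y hy)
    · exact eq_of_star_adj (hU y hy).1 (hU z hz).1 h

lemma filter_adj_switch {K : ℕ} {x : C.Copy} {S : Finset V}
    {p : Σ _ : Finset C.Copy, Finset C.Copy} (hp : p ∈ switches K x S) :
    (switch p.1 p.2).filter (fun y => C.star.Adj x y) = p.2 := by
  obtain ⟨⟨hI, hx⟩, hU, -, hind⟩ := mem_switches.1 hp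
  ext y
  rw [mem_filter, mem_switch]
  constructor
  · rintro ⟨⟨hy, -⟩ | hy, hxy⟩
    · exact absurd hxy (hx y hy)
    · exact hy
  · exact fun hy => ⟨.inr hy, (hU y hy).1⟩

/-- The switches that produce a given colouring have total weight at most `1`: the vertices that
are switched have been recoloured from their lists of copies compatible with the rest of the
colouring, and the rates are at most one over the sizes of these lists. -/
lemma sum_fiber_switches_le_one (L : ℕ) (x : C.Copy) (S : Finset V) {I : Finset C.Copy}
    (hI : I ∈ C.cols S) :
    ∑ p ∈ switches L x S with switch p.1 p.2 = I, ∏ y ∈ p.2, rate L p.1 y ≤ 1 := by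
  set U := I.filter (fun y => C.star.Adj x y) with hUdef
  set E := U.image Sigma.fst with hE
  set B := C.avail (I \ U) with hB
  set Φ := (switches L x S).filter (fun p => switch p.1 p.2 = I) with hΦ
  have hfst : Set.InjOn Sigma.fst (U : Set C.Copy) :=
    (mem_cols.1 hI).2.2.mono (by intro y hy; exact (mem_filter.1 hy).1)
  have hpU : ∀ p ∈ Φ, p.2 = U := by
    intro p hp
    obtain ⟨hp, hsw⟩ := mem_filter.1 hp
    rw [hUdef, ← hsw, filter_adj_switch hp]
  have hsub : ∀ p ∈ Φ, I \ U ⊆ p.1 := by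
    intro p hp z hz
    obtain ⟨hzI, hzU⟩ := mem_sdiff.1 hz
    rw [← (mem_filter.1 hp).2, mem_switch, hpU p hp] at hzI
    exact (hzI.resolve_right hzU).1
  have hpE : ∀ p ∈ Φ, ∀ z ∈ p.1, z.1 ∉ E → z ∈ I \ U := by
    intro p hp z hz hzE
    rw [mem_sdiff]
    refine ⟨?_, fun h => hzE (mem_image_of_mem _ h)⟩
    rw [← (mem_filter.1 hp).2, mem_switch, hpU p hp]
    refine .inl ⟨hz, fun y hy h => hzE (h ▸ mem_image_of_mem _ hy)⟩
  have hcard : #Φ ≤ ∏ u ∈ E, #(B u) := by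
    refine le_trans ?_ (card_colorings_le_prod (C := C) fst_eq_of_mem_avail E)
    refine card_le_card_of_injOn (fun p => p.1.filter fun z => z.1 ∈ E) ?_ ?_
    · intro p hp
      rw [mem_coe] at hp ⊢
      obtain ⟨⟨hI', -⟩, hU', -⟩ := mem_switches.1 (mem_filter.1 hp).1
      obtain ⟨h1, h2, h3⟩ := mem_cols.1 hI'
      refine mem_colorings.2 ⟨?_, ?_, ?_, ?_⟩
      · exact fun y hy => (h1 y (mem_filter.1 hy).1).mono (filter_subset _ _)
      · ext v
        simp only [mem_image, mem_filter]
        constructor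
        · rintro ⟨z, ⟨-, hz⟩, rfl⟩
          exact hz
        · intro hv
          have hvS : v ∈ S := by
            obtain ⟨y, hy, rfl⟩ := mem_image.1 hv
            exact fst_mem_of_mem_colorings hI (mem_filter.1 hy).1
          obtain ⟨z, hz, rfl⟩ := exists_mem_of_mem_colorings hI' hvS
          exact ⟨z, ⟨hz, hv⟩, rfl⟩
      · exact h3.mono (by intro z hz; exact (mem_filter.1 hz).1)
      · intro y hy
        exact mem_avail.2 ⟨rfl, (h1 y (mem_filter.1 hy).1).mono (hsub p hp)⟩
    · rintro ⟨I₁, U₁⟩ hp ⟨I₂, U₂⟩ hp' heq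
      rw [mem_coe] at hp hp'
      obtain rfl : U₁ = U₂ := (hpU _ hp).trans (hpU _ hp').symm
      simp only at heq
      suffices I₁ = I₂ by rw [this]
      ext z
      by_cases hz : z.1 ∈ E
      · have := congrArg (z ∈ ·) heq
        simpa [hz] using this
      · exact ⟨fun h => hsub _ hp' (hpE _ hp z h hz), fun h => hsub _ hp (hpE _ hp' z h hz)⟩
  have hBpos : ∀ y ∈ U, 0 < #(B y.1) := by
    intro y hy
    refine card_pos.2 ⟨y, mem_avail.2 ⟨rfl, ?_⟩⟩
    exact ((mem_cols.1 hI).1 y (mem_filter.1 hy).1).mono sdiff_subset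
  calc ∑ p ∈ Φ, ∏ y ∈ p.2, rate L p.1 y
      ≤ ∑ p ∈ Φ, ∏ y ∈ U, (#(B y.1) : ℝ)⁻¹ := by
        refine sum_le_sum fun p hp => ?_
        rw [hpU p hp]
        refine prod_le_prod (fun y _ => by unfold rate; positivity) fun y hy => ?_
        refine inv_anti₀ (by exact_mod_cast hBpos y hy) ?_
        have hUL : #U ≤ L := hpU p hp ▸ (mem_switches.1 (mem_filter.1 hp).1).2.2.1
        have hle : #(B y.1) ≤ #(C.avail p.1 y.1) + #U := by
          set T := p.1.filter (fun z => z.1 ∈ E) with hT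
          have h1 : #T ≤ #U := by
            rw [← card_image_of_injOn hfst, ← hE]
            refine card_le_card_of_injOn Sigma.fst (fun z hz => (mem_filter.1 hz).2) ?_
            refine ((mem_cols.1 (mem_switches.1 (mem_filter.1 hp).1).1.1).2.2).mono ?_
            exact fun z hz => (mem_filter.1 hz).1
          have h2 : p.1 ⊆ I \ U ∪ T := by
            intro z hz
            by_cases hzE : z.1 ∈ E
            · exact mem_union_right _ (mem_filter.2 ⟨hz, hzE⟩)
            · exact mem_union_left _ (hpE p hp z hz hzE)
          have h3 := card_le_card (avail_anti h2 y.1)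
          have h4 : #(B y.1) ≤ _ := card_avail_le_add (I \ U) T y.1
          omega
        exact_mod_cast hle.trans (by omega)
    _ = #Φ * ∏ y ∈ U, (#(B y.1) : ℝ)⁻¹ := by rw [sum_const, nsmul_eq_mul]
    _ ≤ (∏ u ∈ E, #(B u) : ℕ) * ∏ y ∈ U, (#(B y.1) : ℝ)⁻¹ := by
        exact mul_le_mul_of_nonneg_right (Nat.cast_le.2 hcard)
          (prod_nonneg fun y _ => inv_nonneg.2 (Nat.cast_nonneg _))
    _ = 1 := by
        rw [hE, prod_image hfst]
        push_cast
        rw [← prod_mul_distrib]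
        refine prod_eq_one fun y hy => mul_inv_cancel₀ ?_
        exact_mod_cast (hBpos y hy).ne'

lemma sum_switches_le (L : ℕ) (x : C.Copy) (S : Finset V) :
    ∑ p ∈ switches L x S, ∏ y ∈ p.2, rate L p.1 y ≤ #(C.cols S) := by
  rw [← sum_fiberwise_of_maps_to (fun p hp => switch_mem_cols hp)]
  calc _ ≤ ∑ I ∈ C.cols S, (1 : ℝ) := sum_le_sum fun I hI => sum_fiber_switches_le_one L x S hI
    _ = _ := by simp

/-- A colouring in which `x` has few coloured neighbours, each with many available copies, arises
from switches of substantial total weight. -/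
lemma le_sum_fiber_switches {M L : ℕ} (hML : M ≤ L) (hL : 1 ≤ L) {x : C.Copy} {S : Finset V}
    {I : Finset C.Copy} (hI : I ∈ C.cols S)
    (hM : #(I.filter fun y => C.star.Adj x y) ≤ M)
    (hav : ∀ y ∈ I, C.star.Adj x y → 6 * L ≤ #(C.avail I y.1)) :
    (1 / 2 : ℝ) ^ M ≤
      ∑ p ∈ switches M x S with switch p.1 p.2 = I, ∏ y ∈ p.2, rate L p.1 y := by
  set U := I.filter (fun y => C.star.Adj x y) with hUdef
  set E := U.image Sigma.fst with hE
  -- avoiding `x` keeps the new colours out of the neighbourhood of `x`, avoiding `U` keeps `U`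
  -- switchable
  set B := C.avail (insert x I) with hB
  set Φ := (switches M x S).filter (fun p => switch p.1 p.2 = I) with hΦ
  obtain ⟨h1, h2, h3⟩ := mem_cols.1 hI
  have hUI : U ⊆ I := filter_subset _ _
  have hfst : Set.InjOn Sigma.fst (U : Set C.Copy) := h3.mono (by exact_mod_cast hUI)
  have hEU : #E = #U := card_image_of_injOn hfst
  have hRE : ∀ z ∈ I \ U, z.1 ∉ E := by
    intro z hz hzE
    obtain ⟨hzI, hzU⟩ := mem_sdiff.1 hz
    obtain ⟨y, hy, hyz⟩ := mem_image.1 hzE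
    exact hzU (h3 (hUI hy) hzI hyz ▸ hy)
  have hmap : ∀ T ∈ C.colorings B E, (⟨I \ U ∪ T, U⟩ : Σ _ : Finset C.Copy, Finset C.Copy) ∈ Φ := by
    intro T hT
    obtain ⟨t1, t2, t3, t4⟩ := mem_colorings.1 hT
    have t5 : ∀ z ∈ T, C.Free (insert x I) z := fun z hz => (mem_avail.1 (t4 z hz)).2
    have t6 : ∀ z ∈ T, z.1 ∈ E := fun z hz => fst_mem_of_mem_colorings hT hz
    refine mem_filter.2 ⟨mem_switches.2 ⟨⟨mem_cols.2 ⟨?_, ?_, ?_⟩, ?_⟩, ?_, hM, ?_⟩, ?_⟩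
    · intro y hy z hz
      rcases mem_union.1 hy with hy | hy <;> rcases mem_union.1 hz with hz | hz
      · exact h1 y (mem_sdiff.1 hy).1 z (mem_sdiff.1 hz).1
      · exact fun h => t5 z hz y (mem_insert_of_mem (mem_sdiff.1 hy).1) h.symm
      · exact t5 y hy z (mem_insert_of_mem (mem_sdiff.1 hz).1)
      · exact t1 y hy z hz
    · rw [image_union, t2, hE, ← image_union, sdiff_union_of_subset hUI, h2]
    · intro y hy z hz h
      rcases mem_union.1 hy with hy | hy <;> rcases mem_union.1 hz with hz | hz
      · exact h3 (mem_sdiff.1 hy).1 (mem_sdiff.1 hz).1 h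
      · exact absurd (h ▸ t6 z hz) (hRE y hy)
      · exact absurd (h ▸ t6 y hy) (hRE z hz)
      · exact t3 hy hz h
    · intro z hz hxz
      rcases mem_union.1 hz with hz | hz
      · exact (mem_sdiff.1 hz).2 (mem_filter.2 ⟨(mem_sdiff.1 hz).1, hxz⟩)
      · exact t5 z hz x (mem_insert_self _ _) hxz.symm
    · intro y hy
      refine ⟨(mem_filter.1 hy).2, fst_mem_of_mem_colorings hI (hUI hy), ?_⟩
      intro z hz
      rcases mem_union.1 hz with hz | hz
      · exact h1 y (hUI hy) z (mem_sdiff.1 hz).1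
      · exact fun h => t5 z hz y (mem_insert_of_mem (hUI hy)) h.symm
    · exact fun y hy => (h1 y (hUI hy)).mono hUI
    · ext z
      rw [mem_switch]
      constructor
      · rintro (⟨hz, hzU⟩ | hz)
        · rcases mem_union.1 hz with hz | hz
          · exact (mem_sdiff.1 hz).1
          · obtain ⟨y, hy, hyz⟩ := mem_image.1 (t6 z hz)
            exact absurd hyz (hzU y hy)
        · exact hUI hz
      · intro hz
        by_cases hzU : z ∈ U
        · exact .inr hzU
        · have hzR : z ∈ I \ U := mem_sdiff.2 ⟨hz, hzU⟩
          exact .inl ⟨mem_union_left _ hzR, fun y hy h => hRE z hzR (h ▸ mem_image_of_mem _ hy)⟩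
  have hinj : Set.InjOn (fun T => (⟨I \ U ∪ T, U⟩ : Σ _ : Finset C.Copy, Finset C.Copy))
      (C.colorings B E : Set (Finset C.Copy)) := by
    intro T hT T' hT' h
    simp only [Sigma.mk.injEq, heq_eq_eq, and_true] at h
    have key : ∀ T ∈ C.colorings B E, (I \ U ∪ T).filter (fun z => z.1 ∈ E) = T := by
      intro T hT
      ext z
      rw [mem_filter, mem_union]
      constructor
      · rintro ⟨hz | hz, hzE⟩
        · exact absurd hzE (hRE z hz)
        · exact hz
      · exact fun hz => ⟨.inr hz, fst_mem_of_mem_colorings hT hz⟩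
    rw [← key T hT, h, key T' hT']
  have hrate : ∀ T : Finset C.Copy, ∀ y ∈ U,
      ((#(C.avail I y.1) : ℝ) + 2 * L)⁻¹ ≤ rate L (I \ U ∪ T) y := by
    intro T y hy
    unfold rate
    refine inv_anti₀ (by positivity) ?_
    have e1 := card_le_card (avail_anti (subset_union_left : I \ U ⊆ I \ U ∪ T) y.1)
    have e2 := card_avail_le_add (I \ U) U y.1
    rw [sdiff_union_of_subset hUI] at e2
    have : #(C.avail (I \ U ∪ T) y.1) + L ≤ #(C.avail I y.1) + 2 * L := by omega
    exact_mod_cast this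
  calc (1 / 2 : ℝ) ^ M ≤ (1 / 2 : ℝ) ^ #U :=
        pow_le_pow_of_le_one (by norm_num) (by norm_num) hM
    _ = ∏ y ∈ U, (1 / 2 : ℝ) := by rw [prod_const]
    _ ≤ ∏ y ∈ U, ((#(B y.1) - #U : ℕ) : ℝ) * ((#(C.avail I y.1) : ℝ) + 2 * L)⁻¹ := by
        refine prod_le_prod (fun _ _ => by norm_num) fun y hy => ?_
        have e1 := hav y (hUI hy) (mem_filter.1 hy).2
        have e2 := card_avail_le_add I {x} y.1
        rw [union_comm, ← insert_eq, card_singleton] at e2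
        have e3 : #(C.avail I y.1) + 2 * L ≤ 2 * (#(B y.1) - #U) := by
          have : #(C.avail I y.1) ≤ #(B y.1) + 1 := e2
          omega
        have e4 : (#(C.avail I y.1) : ℝ) + 2 * L ≤ 2 * ((#(B y.1) - #U : ℕ) : ℝ) := by
          exact_mod_cast e3
        have e5 : (0 : ℝ) < #(C.avail I y.1) + 2 * L := by
          have : (1 : ℝ) ≤ L := by exact_mod_cast hL
          positivity
        rw [← div_eq_mul_inv, le_div_iff₀ e5]
        linarith
    _ = ((∏ u ∈ E, (#(B u) - #U) : ℕ) : ℝ) * ∏ y ∈ U, ((#(C.avail I y.1) : ℝ) + 2 * L)⁻¹ := by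
        rw [hE, prod_image hfst, prod_mul_distrib]
        push_cast
        rfl
    _ ≤ (#(C.colorings B E) : ℝ) * ∏ y ∈ U, ((#(C.avail I y.1) : ℝ) + 2 * L)⁻¹ := by
        exact mul_le_mul_of_nonneg_right
          (Nat.cast_le.2 (prod_le_card_colorings fst_eq_of_mem_avail E _ hEU.le))
          (prod_nonneg fun y _ => by positivity)
    _ = ∑ T ∈ C.colorings B E, ∏ y ∈ U, ((#(C.avail I y.1) : ℝ) + 2 * L)⁻¹ := by
        rw [sum_const, nsmul_eq_mul]
    _ ≤ ∑ T ∈ C.colorings B E, ∏ y ∈ U, rate L (I \ U ∪ T) y :=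
        sum_le_sum fun T _ => prod_le_prod (fun y _ => by positivity) (hrate T)
    _ = ∑ p ∈ (C.colorings B E).image
          (fun T => (⟨I \ U ∪ T, U⟩ : Σ _ : Finset C.Copy, Finset C.Copy)),
          ∏ y ∈ p.2, rate L p.1 y := by
        rw [sum_image hinj]
    _ ≤ ∑ p ∈ Φ, ∏ y ∈ p.2, rate L p.1 y := by
        refine sum_le_sum_of_subset_of_nonneg ?_ fun p _ _ =>
          prod_nonneg fun y _ => by unfold rate; positivity
        intro p hp
        obtain ⟨T, hT, rfl⟩ := mem_image.1 hp
        exact hmap T hT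

lemma card_mul_le_sum_switches {M L : ℕ} (hML : M ≤ L) (hL : 1 ≤ L) (x : C.Copy) (S : Finset V) :
    (#((C.cols S).filter fun I => #(I.filter fun y => C.star.Adj x y) ≤ M ∧
      ∀ y ∈ I, C.star.Adj x y → 6 * L ≤ #(C.avail I y.1)) : ℝ) * (1 / 2) ^ M ≤
      ∑ p ∈ switches M x S, ∏ y ∈ p.2, rate L p.1 y := by
  rw [← sum_fiberwise_of_maps_to (t := C.cols S) (fun p hp => switch_mem_cols hp),
    ← nsmul_eq_mul, ← sum_const]
  refine (sum_le_sum fun I hI => ?_).trans (sum_le_sum_of_subset_of_nonneg (filter_subset _ _)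
    fun I _ _ => sum_nonneg fun p _ => prod_nonneg fun y _ => by unfold rate; positivity)
  obtain ⟨hI, hM, hav⟩ := mem_filter.1 hI
  exact le_sum_fiber_switches hML hL hI hM hav

end DPCover

end Switching

/-! ### Random sparsification -/

section Sparsification

open Finset
open scoped Classical

/-- The probability that a random subset of `A`, containing each `y` independently with
probability `p y`, is `A'`. -/
noncomputable def sparsifyWeight {α : Type*} [DecidableEq α] (p : α → ℝ) (A A' : Finset α) : ℝ :=
  (∏ y ∈ A', p y) * ∏ y ∈ A \ A', (1 - p y)

lemma sum_sparsifyWeight {α : Type*} [DecidableEq α] (p : α → ℝ) (A : Finset α) :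
    ∑ A' ∈ A.powerset, sparsifyWeight p A A' = 1 := by
  unfold sparsifyWeight
  rw [← prod_add]
  simp

lemma sum_sparsifyWeight_superset {α : Type*} [DecidableEq α] (p : α → ℝ) {A U : Finset α}
    (hU : U ⊆ A) :
    ∑ A' ∈ A.powerset with U ⊆ A', sparsifyWeight p A A' = ∏ y ∈ U, p y := by
  have h := prod_add p (fun y => if y ∈ U then 0 else 1 - p y) A
  have h1 : ∏ y ∈ A, (p y + if y ∈ U then 0 else 1 - p y) = ∏ y ∈ U, p y := by
    rw [← prod_subset hU]
    · exact prod_congr rfl fun y hy => by simp [hy]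
    · intro y _ hy
      simp [hy]
  rw [← h1, h, sum_filter]
  refine sum_congr rfl fun A' hA' => ?_
  split_ifs with hs
  · unfold sparsifyWeight
    congr 1
    refine prod_congr rfl fun y hy => ?_
    rw [if_neg fun hyU => (mem_sdiff.1 hy).2 (hs hyU)]
  · obtain ⟨y, hyU, hy⟩ := not_subset.1 hs
    rw [prod_eq_zero (mem_sdiff.2 ⟨hU hyU, hy⟩) (by simp [hyU]), mul_zero]

lemma sparsifyWeight_nonneg {α : Type*} [DecidableEq α] {p : α → ℝ} (h0 : ∀ y, 0 ≤ p y)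
    (h1 : ∀ y, p y ≤ 1) (A A' : Finset α) : 0 ≤ sparsifyWeight p A A' :=
  mul_nonneg (prod_nonneg fun y _ => h0 y) (prod_nonneg fun y _ => sub_nonneg.2 (h1 y))

namespace DPCover

variable {V : Type*} [Fintype V] {G : SimpleGraph V} {k : ℕ} {C : DPCover G k}

lemma sum_smallIndep (p : C.Copy → ℝ) (K : ℕ) (A : Finset C.Copy) :
    ∑ U ∈ C.smallIndep K A, ∏ y ∈ U, p y =
      ∑ A' ∈ A.powerset, sparsifyWeight p A A' * #(C.smallIndep K A') := by
  have h : ∀ A' ∈ A.powerset, sparsifyWeight p A A' * #(C.smallIndep K A') =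
      ∑ U ∈ C.smallIndep K A, if U ⊆ A' then sparsifyWeight p A A' else 0 := by
    intro A' hA'
    rw [← sum_filter, sum_const, nsmul_eq_mul, mul_comm]
    congr 3
    ext U
    simp only [smallIndep, mem_filter, mem_powerset] at hA' ⊢
    exact ⟨fun h => ⟨⟨h.1.trans hA', h.2⟩, h.1⟩, fun h => ⟨h.2, h.1.2⟩⟩
  rw [sum_congr rfl h, sum_comm]
  refine sum_congr rfl fun U hU => ?_
  rw [← sum_filter, sum_sparsifyWeight_superset]
  exact mem_powerset.1 (mem_filter.1 hU).1

/-- If among the independent sets in the neighbourhood of `x` those of size at most `M` are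
either few, or rare compared with those of size at most `L`, then `x` is compatible with a good
part of the colourings. -/
lemma card_filter_mul_le {M L : ℕ} (hML : M ≤ L) (hL : 1 ≤ L) {D ε : ℝ} (hD : 0 ≤ D) (hε : 0 ≤ ε)
    {x : C.Copy} (S : Finset V)
    (hZ : ∀ A ⊆ C.nbr x, (#(C.smallIndep M A) : ℝ) ≤ D + ε * #(C.smallIndep L A)) :
    (#((C.cols S).filter fun I => #(I.filter fun y => C.star.Adj x y) ≤ M ∧
      ∀ y ∈ I, C.star.Adj x y → 6 * L ≤ #(C.avail I y.1)) : ℝ) * (1 / 2) ^ M ≤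
      D * #((C.cols S).filter fun I => C.Free I x) + ε * #(C.cols S) := by
  have h0 : ∀ I y, 0 ≤ rate (C := C) L I y := fun I y => by unfold rate; positivity
  have h1 : ∀ I y, rate (C := C) L I y ≤ 1 := by
    intro I y
    unfold rate
    apply inv_le_one_of_one_le₀
    have : (1 : ℝ) ≤ L := by exact_mod_cast hL
    have : (0 : ℝ) ≤ #(C.avail I y.1) := by positivity
    linarith
  calc _ ≤ ∑ p ∈ switches M x S, ∏ y ∈ p.2, rate L p.1 y := card_mul_le_sum_switches hML hL x S
    _ = ∑ I ∈ freeCols x S, ∑ A ∈ (targets x S I).powerset,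
          sparsifyWeight (rate L I) (targets x S I) A * #(C.smallIndep M A) := by
        rw [switches, sum_sigma]
        exact sum_congr rfl fun I _ => sum_smallIndep (rate L I) M (targets x S I)
    _ ≤ ∑ I ∈ freeCols x S, ∑ A ∈ (targets x S I).powerset,
          sparsifyWeight (rate L I) (targets x S I) A * (D + ε * #(C.smallIndep L A)) := by
        refine sum_le_sum fun I _ => sum_le_sum fun A hA => ?_
        refine mul_le_mul_of_nonneg_left (hZ A ?_) (sparsifyWeight_nonneg (h0 I) (h1 I) _ _)
        exact (mem_powerset.1 hA).trans (filter_subset _ _)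
    _ = ∑ I ∈ freeCols x S, (D + ε * ∑ U ∈ C.smallIndep L (targets x S I),
          ∏ y ∈ U, rate L I y) := by
        refine sum_congr rfl fun I _ => ?_
        rw [sum_smallIndep, mul_sum]
        simp_rw [mul_add]
        rw [sum_add_distrib, ← sum_mul, sum_sparsifyWeight, one_mul]
        congr 1
        exact sum_congr rfl fun A _ => by ring
    _ = D * #(freeCols x S) + ε * ∑ p ∈ switches L x S, ∏ y ∈ p.2, rate L p.1 y := by
        rw [sum_add_distrib, sum_const, nsmul_eq_mul, ← mul_sum, switches, sum_sigma, mul_comm D]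
    _ ≤ _ := by
        gcongr
        · exact le_rfl
        · exact sum_switches_le L x S

end DPCover

end Sparsification

/-! ### Independent sets in graphs without large cliques -/

section IndependentSets

open Finset
open scoped Classical

/-- A graph without `K_{s+1}` on at least `a ^ s` vertices has an independent set of size `a`. -/
lemma SimpleGraph.exists_indep_of_pow_le {X : Type*} [Fintype X] (Γ : SimpleGraph X)
    (a : ℕ) (s : ℕ) : ∀ A : Finset X, a ^ s ≤ #A →
      (∀ K ⊆ A, Γ.IsClique (K : Set X) → #K ≤ s) →
      ∃ J ⊆ A, #J = a ∧ ∀ y ∈ J, ∀ z ∈ J, ¬ Γ.Adj y z := by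
  induction s with
  | zero =>
    intro A hA hK
    exfalso
    obtain ⟨y, hy⟩ := card_pos.1 (lt_of_lt_of_le (by simp) hA)
    have := hK {y} (by simpa using hy) (by simp)
    simp at this
  | succ s ih =>
    intro A hA hK
    -- a maximal independent set `J` together with its neighbourhoods covers `A`
    obtain ⟨J, hJ⟩ := Finset.exists_maximal
      (s := A.powerset.filter fun J => ∀ y ∈ J, ∀ z ∈ J, ¬ Γ.Adj y z) ⟨∅, by simp⟩
    have hJA : J ⊆ A := mem_powerset.1 (mem_filter.1 hJ.prop).1
    have hJi : ∀ y ∈ J, ∀ z ∈ J, ¬ Γ.Adj y z := (mem_filter.1 hJ.prop).2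
    rcases le_or_gt a (#J) with h | h
    · obtain ⟨J', hJ', hc⟩ := exists_subset_card_eq h
      exact ⟨J', hJ'.trans hJA, hc, fun y hy z hz => hJi y (hJ' hy) z (hJ' hz)⟩
    have hcov : A ⊆ J.biUnion fun y => insert y (A.filter fun z => Γ.Adj y z) := by
      intro z hz
      rw [mem_biUnion]
      by_contra hcon
      push Not at hcon
      have hzJ : z ∉ J := fun h => hcon z h (mem_insert_self _ _)
      have hadj : ∀ y ∈ J, ¬ Γ.Adj y z := fun y hy h =>
        hcon y hy (mem_insert_of_mem (mem_filter.2 ⟨hz, h⟩))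
      refine hzJ (hJ.le_of_ge (y := insert z J) ?_ (subset_insert _ _) (mem_insert_self z J))
      rw [mem_filter, mem_powerset]
      refine ⟨insert_subset hz hJA, ?_⟩
      intro y hy w hw
      rw [mem_insert] at hy hw
      rcases hy with rfl | hy <;> rcases hw with rfl | hw
      · exact Γ.loopless.irrefl _
      · exact fun h => hadj w hw h.symm
      · exact hadj y hy
      · exact hJi y hy w hw
    have hex : ∃ y ∈ J, a ^ s ≤ #(A.filter fun z => Γ.Adj y z) := by
      by_contra hcon
      push Not at hcon
      have h1 := (card_le_card hcov).trans (card_biUnion_le_card_mul _ _ (a ^ s) fun y hy =>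
        (card_insert_le _ _).trans (hcon y hy))
      have h2 : #J * a ^ s < a * a ^ s :=
        Nat.mul_lt_mul_of_pos_right h (pow_pos (by omega) _)
      rw [pow_succ, mul_comm] at hA
      omega
    obtain ⟨y, hy, hdeg⟩ := hex
    obtain ⟨J', hJ', hc, hi⟩ := ih (A.filter fun z => Γ.Adj y z) hdeg (by
      intro K hKA hKc
      have hyK : y ∉ K := fun h => Γ.loopless.irrefl _ (mem_filter.1 (hKA h)).2
      have := hK (insert y K) (insert_subset (hJA hy) (hKA.trans (filter_subset _ _))) (by
        rw [coe_insert]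
        exact hKc.insert fun z hz _ => (mem_filter.1 (hKA hz)).2)
      rw [card_insert_of_notMem hyK] at this
      omega)
    exact ⟨J', hJ'.trans (filter_subset _ _), hc, hi⟩

lemma card_powerset_filter_card_le {X : Type*} (A : Finset X) (M : ℕ) :
    #(A.powerset.filter fun U => #U ≤ M) ≤ (#A + 1) ^ M := by
  induction M with
  | zero => simp [filter_eq']
  | succ M ih =>
    -- a set of size at most `M + 1` is a set of size at most `M` with at most one extra element
    calc #(A.powerset.filter fun U => #U ≤ M + 1)
        ≤ #((A.powerset.filter fun U => #U ≤ M) ×ˢ insertNone A) := by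
          refine card_le_card_of_surjOn
            (fun p => p.2.elim p.1 fun y => insert y p.1) ?_
          intro U hU
          simp only [coe_filter, mem_powerset, Set.mem_ofPred_eq] at hU
          simp only [Set.mem_image, mem_coe, mem_product, mem_filter, mem_powerset]
          rcases hU.2.lt_or_eq with h | h
          · exact ⟨(U, none), ⟨⟨hU.1, Nat.lt_succ_iff.1 h⟩, by simp⟩, rfl⟩
          · obtain ⟨y, hy⟩ := card_pos.1 (by omega : 0 < #U)
            refine ⟨(U.erase y, some y), ⟨⟨(erase_subset _ _).trans hU.1, ?_⟩, ?_⟩, ?_⟩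
            · rw [card_erase_of_mem hy]; omega
            · simpa using hU.1 hy
            · simp [insert_erase hy]
      _ ≤ (#A + 1) ^ M * (#A + 1) := by
          rw [card_product, card_insertNone]
          gcongr
      _ = _ := (pow_succ _ _).symm

namespace DPCover

variable {V : Type*} [Fintype V] {G : SimpleGraph V} {k : ℕ} {C : DPCover G k}

lemma card_smallIndep_le (M : ℕ) (A : Finset C.Copy) : #(C.smallIndep M A) ≤ (#A + 1) ^ M :=
  (card_le_card fun U hU => by
    rw [smallIndep, mem_filter] at hU
    exact mem_filter.2 ⟨hU.1, hU.2.1⟩).trans (card_powerset_filter_card_le A M)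

lemma two_pow_le_card_smallIndep {q a L : ℕ} (hC : C.IsCliqueFree (q + 2)) (haL : a ≤ L)
    {x : C.Copy} {A : Finset C.Copy} (hA : A ⊆ C.nbr x) (ha : a ^ q ≤ #A) :
    2 ^ a ≤ #(C.smallIndep L A) := by
  obtain ⟨J, hJA, hJ, hind⟩ := C.star.exists_indep_of_pow_le a q A ha (by
    intro K hKA hK
    by_contra hcon
    obtain ⟨K', hK'K, hK'⟩ := exists_subset_card_eq (by omega : q + 1 ≤ #K)
    have hxK : x ∉ K' := fun h => C.star.loopless.irrefl _ (mem_nbr.1 (hA (hKA (hK'K h))))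
    refine hC (insert x K') ⟨?_, by rw [card_insert_of_notMem hxK, hK']⟩
    rw [coe_insert]
    exact (hK.subset (by exact_mod_cast hK'K)).insert fun z hz _ =>
      mem_nbr.1 (hA (hKA (hK'K hz))))
  rw [← hJ, ← card_powerset]
  refine card_le_card fun U hU => ?_
  rw [mem_powerset] at hU
  refine mem_filter.2 ⟨mem_powerset.2 (hU.trans hJA), ?_, ?_⟩
  · exact (card_le_card hU).trans (hJ.le.trans haL)
  · exact fun y hy z hz => hind y (hU hy) z (hU hz)

lemma card_nbr_le [DecidableRel G.Adj] (x : C.Copy) : #(C.nbr x) ≤ G.maxDegree := by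
  refine le_trans ?_ (G.degree_le_maxDegree x.1)
  rw [← SimpleGraph.card_neighborFinset_eq_degree]
  refine card_le_card_of_injOn Sigma.fst ?_ ?_
  · intro y hy
    have := mem_nbr.1 hy
    simpa using C.adj_of_adj x y this.1 this.2
  · intro y hy z hz h
    exact eq_of_star_adj (mem_nbr.1 hy) (mem_nbr.1 hz) h

end DPCover

end IndependentSets

/-! ### Induction on the coloured vertex set -/

section Induction

open Finset
open scoped Classical

namespace DPCover

variable {V : Type*} [Fintype V] {G : SimpleGraph V} {k : ℕ} {C : DPCover G k}

/-- A colouring of all vertices is an independent set of size `|V|` of the conflict graph. -/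
lemma colorable_of_nonempty_cols (h : (C.cols univ).Nonempty) : C.Colorable := by
  obtain ⟨I, hI⟩ := h
  obtain ⟨h1, -, h3⟩ := mem_cols.1 hI
  refine ⟨I, ?_, (card_of_mem_colorings hI).trans card_univ⟩
  intro x hx y hy hne hadj
  exact h1 x hx y hy ⟨hadj, fun h => hne (h3 hx hy h)⟩

lemma nonempty_cols_of_mul_card_le {ℓ : ℝ} (hℓ : 0 < ℓ)
    (h : ∀ S : Finset V, ∀ v ∉ S, ℓ * #(C.cols S) ≤ #(C.cols (insert v S))) (S : Finset V) :
    (C.cols S).Nonempty := by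
  rw [← card_pos]
  induction S using Finset.induction_on with
  | empty => simp [cols, card_colorings_empty]
  | insert u S hu ih =>
    have h1 : (0 : ℝ) < #(C.cols S) := by exact_mod_cast ih
    exact_mod_cast (mul_pos hℓ h1).trans_le (h S u hu)

variable [DecidableRel G.Adj]

/-- By Markov's inequality, at least a tenth of the pairs of a copy `x` of `v` and a colouring are
such that `x` has few coloured neighbours, each with many available copies. -/
lemma le_sum_card_good {M t : ℕ} {ℓ : ℝ} {S : Finset V} (v : V)
    (hM : 5 * G.maxDegree ≤ 4 * k * (M + 1)) (hℓ : 10 * (G.maxDegree : ℝ) * t ≤ k * ℓ) (hℓ0 : 0 < ℓ)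
    (ih : ∀ u ∈ S, ℓ * #(C.cols (S.erase u)) ≤ #(C.cols S)) :
    (k : ℝ) / 10 * #(C.cols S) ≤ ∑ x ∈ C.avail ∅ v,
      (#((C.cols S).filter fun I => #(I.filter fun y => C.star.Adj x y) ≤ M ∧
        ∀ y ∈ I, C.star.Adj x y → t ≤ #(C.avail I y.1)) : ℝ) := by
  set good : C.Copy → Finset C.Copy → Prop := fun x I =>
    #(I.filter fun y => C.star.Adj x y) ≤ M ∧
      ∀ y ∈ I, C.star.Adj x y → t ≤ #(C.avail I y.1) with hgood
  have hpt : ∀ x, ∀ I ∈ C.cols S, (1 : ℝ) ≤ (if good x I then 1 else 0) +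
      (#(I.filter fun y => C.star.Adj x y ∧ True) : ℝ) / (M + 1) +
      #(I.filter fun y => C.star.Adj x y ∧ #(C.avail I y.1) ≤ t) := by
    intro x I _
    by_cases h1 : #(I.filter fun y => C.star.Adj x y) ≤ M
    · by_cases h2 : ∀ y ∈ I, C.star.Adj x y → t ≤ #(C.avail I y.1)
      · rw [if_pos ⟨h1, h2⟩]
        have : (0 : ℝ) ≤ (#(I.filter fun y => C.star.Adj x y ∧ True) : ℝ) / (M + 1) := by
          positivity
        have : (0 : ℝ) ≤ #(I.filter fun y => C.star.Adj x y ∧ #(C.avail I y.1) ≤ t) := by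
          positivity
        linarith
      · push Not at h2
        obtain ⟨y, hy, hxy, hlt⟩ := h2
        have h3 : 1 ≤ #(I.filter fun y => C.star.Adj x y ∧ #(C.avail I y.1) ≤ t) :=
          card_pos.2 ⟨y, mem_filter.2 ⟨hy, hxy, hlt.le⟩⟩
        have h3' : (1 : ℝ) ≤ #(I.filter fun y => C.star.Adj x y ∧ #(C.avail I y.1) ≤ t) := by
          exact_mod_cast h3
        have h4 : (0 : ℝ) ≤ (#(I.filter fun y => C.star.Adj x y ∧ True) : ℝ) / (M + 1) := by
          positivity
        have h5 : (0 : ℝ) ≤ if good x I then 1 else 0 := by positivity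
        linarith
    · have h3 : M + 1 ≤ #(I.filter fun y => C.star.Adj x y ∧ True) := by
        simp only [and_true]
        omega
      have h4 : (1 : ℝ) ≤ (#(I.filter fun y => C.star.Adj x y ∧ True) : ℝ) / (M + 1) := by
        rw [one_le_div (by positivity)]
        exact_mod_cast h3
      have h5 : (0 : ℝ) ≤ if good x I then 1 else 0 := by positivity
      have : (0 : ℝ) ≤ #(I.filter fun y => C.star.Adj x y ∧ #(C.avail I y.1) ≤ t) := by
        positivity
      linarith
  have hI : ∀ I ∈ C.cols S, (k : ℝ) ≤ (∑ x ∈ C.avail ∅ v, if good x I then (1 : ℝ) else 0) +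
      (G.maxDegree : ℝ) / (M + 1) +
      #((G.neighborFinset v).filter fun u => u ∈ S ∧ #(C.avail I u) ≤ t) := by
    intro I hI
    have h1 : (k : ℝ) = ∑ x ∈ C.avail ∅ v, (1 : ℝ) := by simp [card_avail_empty]
    have h2 := sum_le_sum fun x (_ : x ∈ C.avail ∅ v) => hpt x I hI
    rw [← h1, sum_add_distrib, sum_add_distrib, ← sum_div] at h2
    have h3 := (sum_card_filter_adj_le hI v fun _ => True).trans
      ((card_filter_le _ _).trans ((G.card_neighborFinset_eq_degree v).trans_le
        (G.degree_le_maxDegree v)))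
    have h4 := sum_card_filter_adj_le hI v fun u => #(C.avail I u) ≤ t
    have h3' : (∑ x ∈ C.avail ∅ v, (#(I.filter fun y => C.star.Adj x y ∧ True) : ℝ)) ≤
        G.maxDegree := by exact_mod_cast h3
    have h4' : (∑ x ∈ C.avail ∅ v,
        (#(I.filter fun y => C.star.Adj x y ∧ #(C.avail I y.1) ≤ t) : ℝ)) ≤
        #((G.neighborFinset v).filter fun u => u ∈ S ∧ #(C.avail I u) ≤ t) := by
      exact_mod_cast h4
    have h5 := div_le_div_of_nonneg_right h3' (by positivity : (0 : ℝ) ≤ (M : ℝ) + 1)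
    linarith
  have hfew : ∑ I ∈ C.cols S,
      (#((G.neighborFinset v).filter fun u => u ∈ S ∧ #(C.avail I u) ≤ t) : ℝ) ≤
      k / 10 * #(C.cols S) := by
    have h1 : ∀ u ∈ G.neighborFinset v,
        (#((C.cols S).filter fun I => u ∈ S ∧ #(C.avail I u) ≤ t) : ℝ) ≤
          t / ℓ * #(C.cols S) := by
      intro u _
      by_cases hu : u ∈ S
      · simp only [hu, true_and]
        have h2 : (#((C.cols S).filter fun I => #(C.avail I u) ≤ t) : ℝ) ≤
            #(C.cols (S.erase u)) * t := by exact_mod_cast card_filter_card_avail_le hu t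
        have h3 := ih u hu
        rw [div_mul_eq_mul_div, le_div_iff₀ hℓ0]
        nlinarith [(Nat.cast_nonneg t : (0 : ℝ) ≤ t)]
      · simp only [hu, false_and, filter_false, card_empty, Nat.cast_zero]
        positivity
    have h2 := sum_card_bipartiteAbove_eq_sum_card_bipartiteBelow (s := C.cols S)
      (t := G.neighborFinset v) fun I u => u ∈ S ∧ #(C.avail I u) ≤ t
    have h2' : ∑ I ∈ C.cols S,
      (#((G.neighborFinset v).filter fun u => u ∈ S ∧ #(C.avail I u) ≤ t) : ℝ) =
      ∑ u ∈ G.neighborFinset v, (#((C.cols S).filter fun I => u ∈ S ∧ #(C.avail I u) ≤ t) : ℝ) := by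
      exact_mod_cast h2
    rw [h2']
    calc _ ≤ ∑ u ∈ G.neighborFinset v, (t / ℓ * #(C.cols S) : ℝ) := sum_le_sum h1
      _ = #(G.neighborFinset v) * (t / ℓ * #(C.cols S) : ℝ) := by rw [sum_const, nsmul_eq_mul]
      _ ≤ G.maxDegree * (t / ℓ * #(C.cols S) : ℝ) := by
          refine mul_le_mul_of_nonneg_right ?_ (by positivity)
          rw [G.card_neighborFinset_eq_degree]
          exact_mod_cast G.degree_le_maxDegree v
      _ = G.maxDegree * t / ℓ * #(C.cols S) := by ring
      _ ≤ _ := by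
          refine mul_le_mul_of_nonneg_right ?_ (by positivity)
          rw [div_le_iff₀ hℓ0]
          linarith
  have hMk : (G.maxDegree : ℝ) / (M + 1) ≤ 4 / 5 * k := by
    rw [div_le_iff₀ (by positivity)]
    have : 5 * (G.maxDegree : ℝ) ≤ 4 * k * (M + 1) := by exact_mod_cast hM
    linarith
  have hsum := sum_le_sum hI
  rw [sum_const, nsmul_eq_mul, sum_add_distrib, sum_add_distrib, sum_comm, sum_const,
    nsmul_eq_mul] at hsum
  have hE : ∀ x ∈ C.avail ∅ v, (∑ I ∈ C.cols S, if good x I then (1 : ℝ) else 0) =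
      (#((C.cols S).filter fun I => good x I) : ℝ) := by
    intro x _
    rw [card_filter]
    push_cast
    rfl
  rw [sum_congr rfl hE] at hsum
  have hmul := mul_le_mul_of_nonneg_left hMk (Nat.cast_nonneg (α := ℝ) #(C.cols S))
  linarith

/-- Adding a vertex multiplies the number of colourings by at least `ℓ`. -/
lemma mul_card_cols_le {M L : ℕ} {ℓ D ε : ℝ} (hML : M ≤ L) (hL : 1 ≤ L) (hD : 0 < D) (hε : 0 ≤ ε)
    (hℓ0 : 0 < ℓ) (hM : 5 * G.maxDegree ≤ 4 * k * (M + 1))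
    (hℓ : 10 * (G.maxDegree : ℝ) * (6 * L : ℕ) ≤ k * ℓ)
    (hεM : 20 * ε ≤ (1 / 2) ^ M) (hk : 20 * ℓ * D ≤ k * (1 / 2) ^ M)
    (hZ : ∀ x : C.Copy, ∀ A ⊆ C.nbr x,
      (#(C.smallIndep M A) : ℝ) ≤ D + ε * #(C.smallIndep L A)) {S : Finset V} :
    ∀ v ∉ S, ℓ * #(C.cols S) ≤ #(C.cols (insert v S)) := by
  induction S using Finset.strongInduction with
  | H S ih =>
    intro v hv
    have ih' : ∀ u ∈ S, ℓ * #(C.cols (S.erase u)) ≤ #(C.cols S) := by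
      intro u hu
      have := ih (S.erase u) (erase_ssubset hu) u (notMem_erase u S)
      rwa [insert_erase hu] at this
    have h1 := le_sum_card_good v hM hℓ hℓ0 ih'
    have h2 := sum_le_sum fun x (_ : x ∈ C.avail ∅ v) =>
      card_filter_mul_le hML hL hD.le hε S (hZ x)
    rw [← sum_mul, sum_add_distrib, ← mul_sum, sum_const, card_avail_empty, nsmul_eq_mul] at h2
    have h3 : (#(C.cols (insert v S)) : ℝ) =
        ∑ x ∈ C.avail ∅ v, (#((C.cols S).filter fun I => C.Free I x) : ℝ) := by
      exact_mod_cast card_cols_insert hv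
    rw [← h3] at h2
    have h4 := mul_le_mul_of_nonneg_right h1 (by positivity : (0 : ℝ) ≤ (1 / 2) ^ M)
    have hF : (0 : ℝ) ≤ #(C.cols S) := Nat.cast_nonneg _
    have h5 := mul_le_mul_of_nonneg_right hk hF
    have h6 := mul_le_mul_of_nonneg_left (mul_le_mul_of_nonneg_right hεM hF)
      (Nat.cast_nonneg (α := ℝ) k)
    have h7 := h4.trans h2
    refine le_of_mul_le_mul_left ?_ hD
    linarith

end DPCover

end Induction

/-! ### Choice of the parameters -/

section Parameters

open Filter

lemma eventually_mul_pow_le_rpow :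
    ∀ᶠ l : ℝ in atTop, 2400 * l ^ 4 ≤ (2 : ℝ) ^ (3 / 16 * l) := by
  have hb : 0 < Real.log 2 * (3 / 16) := by have := Real.log_pos one_lt_two; positivity
  filter_upwards [(isLittleO_pow_exp_pos_mul_atTop (k := 4) hb).def
    (by norm_num : (0 : ℝ) < 1 / 2400)] with l hl
  rw [Real.norm_of_nonneg (by positivity), Real.norm_of_nonneg (by positivity)] at hl
  rw [Real.rpow_def_of_pos two_pos, ← mul_assoc]
  linarith

lemma logb_mul_le_of_le {x y : ℝ} (hx : 4 ≤ x) (hxy : x ≤ y) :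
    Real.logb 2 y * x ≤ Real.logb 2 x * y := by
  have he : Real.exp 1 ≤ x := by linarith [Real.exp_one_lt_d9]
  have h := Real.log_div_self_antitoneOn (show x ∈ {x | Real.exp 1 ≤ x} from he)
    (show y ∈ {x | Real.exp 1 ≤ x} from he.trans hxy) hxy
  simp only at h
  rw [div_le_div_iff₀ (by linarith) (by linarith)] at h
  unfold Real.logb
  rw [div_mul_eq_mul_div, div_mul_eq_mul_div]
  exact div_le_div_of_nonneg_right h (Real.log_pos one_lt_two).le

/-- Sets of size at most `M` in a set of `m` points are few if `m` is polylogarithmic, and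
otherwise rare compared with the subsets of an `a`-set, where `a ^ q` is about `m`. -/
lemma pow_le_or_exists_pow_le {l μ : ℝ} {q M L : ℕ} (hq : 1 ≤ q) (hl : 1024 ≤ l)
    (hμ : μ = Real.logb 2 l) (hμ10 : 10 ≤ μ) (hM : M * (q * μ) ≤ 5 / 8 * l) (hL : l ^ 2 ≤ L)
    {m : ℕ} (hm : (m : ℝ) ≤ 2 ^ l) :
    ((m : ℝ) + 1) ^ M ≤ (2 : ℝ) ^ (3 / 4 * l) ∨
      ∃ a ≤ L, a ^ q ≤ m ∧ ((m : ℝ) + 1) ^ M ≤ (2 : ℝ) ^ (-(1 / 4 * l)) * 2 ^ a := by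
  have hq' : (1 : ℝ) ≤ q := by exact_mod_cast hq
  have hM0 : (0 : ℝ) ≤ M := Nat.cast_nonneg M
  have hqM : (q : ℝ) * M ≤ l / 16 := by nlinarith [mul_nonneg (by positivity : (0 : ℝ) ≤ q) hM0]
  have hMl : (M : ℝ) ≤ l / 16 := by nlinarith
  by_cases hLm : L ^ q ≤ m
  · refine .inr ⟨L, le_rfl, hLm, ?_⟩
    have h1 : (m : ℝ) + 1 ≤ 2 ^ (l + 1) := by
      rw [Real.rpow_add two_pos, Real.rpow_one]
      have : (1 : ℝ) ≤ 2 ^ l := Real.one_le_rpow one_le_two (by linarith)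
      linarith
    calc ((m : ℝ) + 1) ^ M ≤ ((2 : ℝ) ^ (l + 1)) ^ M := by gcongr
      _ = (2 : ℝ) ^ ((l + 1) * M) := by rw [Real.rpow_mul two_pos.le, Real.rpow_natCast]
      _ ≤ (2 : ℝ) ^ (-(1 / 4 * l) + L) := by
          refine Real.rpow_le_rpow_of_exponent_le one_le_two ?_
          nlinarith
      _ = _ := by rw [Real.rpow_add two_pos, Real.rpow_natCast]
  set a := Nat.findGreatest (fun a => a ^ q ≤ m) L with ha
  have haL : a ≤ L := Nat.findGreatest_le L
  have ham : a ^ q ≤ m := Nat.findGreatest_spec (P := fun a => a ^ q ≤ m) (Nat.zero_le L)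
    (by simp [Nat.pos_iff_ne_zero.1 hq])
  have haL' : a < L := lt_of_le_of_ne haL fun h => hLm (h ▸ ham)
  have hma : m + 1 ≤ (a + 1) ^ q := by
    have := Nat.findGreatest_is_greatest (P := fun a => a ^ q ≤ m) (n := L) (k := a + 1)
      (Nat.lt_succ_self _) haL'
    omega
  have hy : (0 : ℝ) < (a : ℝ) + 1 := by positivity
  have hpow : ((m : ℝ) + 1) ^ M ≤ (2 : ℝ) ^ (q * M * Real.logb 2 (a + 1)) := by
    calc ((m : ℝ) + 1) ^ M ≤ (((a : ℝ) + 1) ^ q) ^ M := by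
          gcongr
          exact_mod_cast hma
      _ = (2 : ℝ) ^ (Real.logb 2 (a + 1) * ((q * M : ℕ) : ℝ)) := by
          rw [Real.rpow_mul two_pos.le, Real.rpow_logb two_pos (by norm_num) hy,
            Real.rpow_natCast, pow_mul]
      _ = _ := by push_cast; ring_nf
  have hlog : Real.logb 2 (2 * l) = μ + 1 := by
    rw [Real.logb_mul two_ne_zero (by linarith), Real.logb_self_eq_one one_lt_two, hμ, add_comm]
  have hqMμ : (q : ℝ) * M * (μ + 1) ≤ 11 / 16 * l := by linarith
  have hqM0 : (0 : ℝ) ≤ (q : ℝ) * M := by positivity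
  rcases le_or_gt ((a : ℝ) + 1) (2 * l) with h | h
  · refine .inl (hpow.trans (Real.rpow_le_rpow_of_exponent_le one_le_two ?_))
    have h1 := Real.logb_le_logb_of_le one_lt_two hy h
    rw [hlog] at h1
    have h2 := mul_le_mul_of_nonneg_left h1 hqM0
    linarith
  · refine .inr ⟨a, haL, ham, hpow.trans ?_⟩
    rw [← Real.rpow_natCast 2 a, ← Real.rpow_add two_pos]
    refine Real.rpow_le_rpow_of_exponent_le one_le_two ?_
    have h1 := logb_mul_le_of_le (by linarith : (4 : ℝ) ≤ 2 * l) h.le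
    rw [hlog] at h1
    have h2 := mul_le_mul_of_nonneg_left h1 hqM0
    have h3 := mul_le_mul_of_nonneg_right hqMμ hy.le
    have h4 : q * M * Real.logb 2 (a + 1) ≤ 11 / 32 * (a + 1) := by
      refine le_of_mul_le_mul_right ?_ (by linarith : (0 : ℝ) < 2 * l)
      linarith
    linarith

/-- With `l = log₂ Δ` and `μ = log₂ l`, the parameters are `M ≈ 5 l / (8 q μ)`, so that `M + 1`
is at least `5 Δ / (4 k)`, and `L ≈ l ^ 2`, `ℓ = 120 l ^ 3`, `D = Δ ^ (3 / 4)`,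
`ε = Δ ^ (-1 / 4)`. -/
lemma exists_parameters : ∃ Δ₀ : ℕ, ∀ Δ q k : ℕ, Δ₀ ≤ Δ → 1 ≤ q →
    2 * (q : ℝ) * Δ * (Real.logb 2 (Real.logb 2 Δ) / Real.logb 2 Δ) ≤ k →
    ∃ (M L : ℕ) (ℓ D ε : ℝ), M ≤ L ∧ 1 ≤ L ∧ 0 < D ∧ 0 ≤ ε ∧ 0 < ℓ ∧
      5 * Δ ≤ 4 * k * (M + 1) ∧ 10 * (Δ : ℝ) * (6 * L : ℕ) ≤ k * ℓ ∧
      20 * ε ≤ (1 / 2) ^ M ∧ 20 * ℓ * D ≤ k * (1 / 2) ^ M ∧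
      ∀ m ≤ Δ, ((m : ℝ) + 1) ^ M ≤ D ∨
        ∃ a ≤ L, a ^ q ≤ m ∧ ((m : ℝ) + 1) ^ M ≤ ε * 2 ^ a := by
  have hlog : Tendsto (fun Δ : ℕ => Real.logb 2 Δ) atTop atTop :=
    (Real.tendsto_logb_atTop one_lt_two).comp tendsto_natCast_atTop_atTop
  obtain ⟨Δ₀, hΔ₀⟩ := eventually_atTop.1
    ((hlog.eventually (eventually_mul_pow_le_rpow.and (eventually_ge_atTop 1024))).and
      (eventually_ge_atTop 1))
  refine ⟨Δ₀, fun Δ q k hΔ hq hk => ?_⟩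
  obtain ⟨⟨hpow, hl⟩, hΔ1⟩ := hΔ₀ Δ hΔ
  set l := Real.logb 2 Δ with hldef
  set μ := Real.logb 2 l with hμ
  have hΔpos : (0 : ℝ) < Δ := by exact_mod_cast hΔ1
  have hΔl : (Δ : ℝ) = 2 ^ l := (Real.rpow_logb two_pos (by norm_num) hΔpos).symm
  have hl0 : 0 < l := by linarith
  have hμ10 : 10 ≤ μ := by
    rw [hμ, Real.le_logb_iff_rpow_le one_lt_two hl0]
    norm_num
    exact hl
  have hq' : (1 : ℝ) ≤ q := by exact_mod_cast hq
  have hqμ : 0 < (q : ℝ) * μ := by positivity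
  have hkl : 2 * (q * μ) * Δ ≤ k * l := by
    rw [← div_le_iff₀ hl0]
    refine le_trans (le_of_eq ?_) hk
    ring
  have hqμ1 : 1 ≤ 2 * ((q : ℝ) * μ) := by nlinarith
  have hkΔ : (Δ : ℝ) ≤ k * l := (le_mul_of_one_le_left hΔpos.le hqμ1).trans hkl
  set M := ⌊5 / 8 * l / (q * μ)⌋₊ with hMdef
  set L := ⌈l ^ 2⌉₊ with hLdef
  have hM : M * (q * μ) ≤ 5 / 8 * l := by
    rw [← le_div_iff₀ hqμ]
    exact Nat.floor_le (by positivity)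
  have hM' : 5 / 8 * l ≤ (M + 1) * (q * μ) := by
    rw [← div_le_iff₀ hqμ]
    exact (Nat.lt_floor_add_one _).le
  have hL : l ^ 2 ≤ L := Nat.le_ceil _
  have hL2 : (L : ℝ) ≤ 2 * l ^ 2 := by
    have := Nat.ceil_lt_add_one (by positivity : 0 ≤ l ^ 2)
    nlinarith
  have hMl : (M : ℝ) ≤ 1 / 16 * l := by
    have : (M : ℝ) * 10 ≤ M * (q * μ) := by gcongr; nlinarith
    linarith
  have hhalf : (2 : ℝ) ^ (-(1 / 16 * l)) ≤ (1 / 2) ^ M := by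
    rw [one_div 2, inv_pow, ← Real.rpow_natCast, ← Real.rpow_neg two_pos.le]
    exact Real.rpow_le_rpow_of_exponent_le one_le_two (by linarith)
  refine ⟨M, L, 120 * l ^ 3, 2 ^ (3 / 4 * l), 2 ^ (-(1 / 4 * l)), ?_, ?_, by positivity,
    by positivity, by positivity, ?_, ?_, ?_, ?_, ?_⟩
  · have : (M : ℝ) ≤ L := by nlinarith
    exact_mod_cast this
  · have : (1 : ℝ) ≤ L := by nlinarith
    exact_mod_cast this
  · have h1 := mul_le_mul_of_nonneg_right hkl (by positivity : (0 : ℝ) ≤ (M : ℝ) + 1)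
    have h2 := mul_le_mul_of_nonneg_right hM' hΔpos.le
    have h3 : 5 * (Δ : ℝ) ≤ 4 * k * (M + 1) := by
      refine le_of_mul_le_mul_right ?_ hl0
      linarith
    exact_mod_cast h3
  · push_cast
    have h1 := mul_le_mul_of_nonneg_left hL2 hΔpos.le
    have h2 := mul_le_mul_of_nonneg_right hkΔ (by positivity : 0 ≤ l ^ 2)
    linarith
  · refine le_trans ?_ hhalf
    have h1 : (20 : ℝ) ≤ 2 ^ (5 : ℝ) := by norm_num
    calc 20 * (2 : ℝ) ^ (-(1 / 4 * l)) ≤ 2 ^ (5 : ℝ) * (2 : ℝ) ^ (-(1 / 4 * l)) := by gcongr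
      _ = 2 ^ (5 + -(1 / 4 * l)) := (Real.rpow_add two_pos _ _).symm
      _ ≤ _ := Real.rpow_le_rpow_of_exponent_le one_le_two (by linarith)
  · refine le_trans ?_ (mul_le_mul_of_nonneg_left hhalf (Nat.cast_nonneg k))
    refine le_of_mul_le_mul_right ?_ hl0
    calc 20 * (120 * l ^ 3) * (2 : ℝ) ^ (3 / 4 * l) * l
        = 2400 * l ^ 4 * (2 : ℝ) ^ (3 / 4 * l) := by ring
      _ ≤ (2 : ℝ) ^ (3 / 16 * l) * (2 : ℝ) ^ (3 / 4 * l) := by gcongr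
      _ = (2 : ℝ) ^ l * (2 : ℝ) ^ (-(1 / 16 * l)) := by
          rw [← Real.rpow_add two_pos, ← Real.rpow_add two_pos]
          ring_nf
      _ ≤ k * l * (2 : ℝ) ^ (-(1 / 16 * l)) := by
          rw [← hΔl]
          gcongr
      _ = _ := by ring
  · intro m hm
    refine pow_le_or_exists_pow_le hq hl rfl hμ10 hM hL ?_
    rw [← hΔl]
    exact_mod_cast hm

end Parameters

/-! ### The colouring theorem -/

theorem theorem8 (r : ℕ) (hr : 4 ≤ r) :
    ∃ Δr : ℕ, ∀ (V : Type*) [Fintype V] (G : SimpleGraph V) [DecidableRel G.Adj],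
      Δr ≤ G.maxDegree →
      ∀ (k : ℕ) (C : DPCover G k), C.IsCliqueFree r →
        2 * ((r : ℝ) - 2) * (G.maxDegree : ℝ) *
            (Real.logb 2 (Real.logb 2 (G.maxDegree : ℝ)) / Real.logb 2 (G.maxDegree : ℝ))
          ≤ (k : ℝ) →
        C.Colorable := by
  obtain ⟨Δ₀, hΔ₀⟩ := exists_parameters
  refine ⟨Δ₀, fun V _ G _ hΔ k C hC hk => ?_⟩
  obtain ⟨q, rfl⟩ : ∃ q, r = q + 2 := ⟨r - 2, by omega⟩
  rw [Nat.cast_add, Nat.cast_ofNat, add_sub_cancel_right] at hk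
  obtain ⟨M, L, ℓ, D, ε, hML, hL, hD, hε, hℓ0, hM, hℓ, hεM, hkM, hm⟩ :=
    hΔ₀ G.maxDegree q k hΔ (by omega) hk
  refine DPCover.colorable_of_nonempty_cols (DPCover.nonempty_cols_of_mul_card_le hℓ0
    (fun S => DPCover.mul_card_cols_le hML hL hD hε hℓ0 hM hℓ hεM hkM ?_) _)
  intro x A hA
  have h1 : (((C.smallIndep M A).card : ℕ) : ℝ) ≤ ((A.card : ℝ) + 1) ^ M := by
    exact_mod_cast DPCover.card_smallIndep_le M A
  rcases hm A.card ((Finset.card_le_card hA).trans (DPCover.card_nbr_le x)) with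
    h | ⟨a, haL, ham, h⟩
  · exact h1.trans (h.trans (le_add_of_nonneg_right (by positivity)))
  · have h2 : (2 : ℝ) ^ a ≤ (C.smallIndep L A).card := by
      exact_mod_cast DPCover.two_pow_le_card_smallIndep hC haL hA ham
    have h3 := mul_le_mul_of_nonneg_left h2 hε
    linarith
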